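/- Let $I_\nu(x)=\sum_{k\ge 0}\frac{(x/2)^{\nu+2k}}{k!\,\Gamma(\nu+k+1)}$ be the modified Bessel function of the first kind (with $1/\Gamma=0$ at the poles of $\Gamma$) and let $Q_M(\alpha,\beta)=\alpha^{-(M-1)}\int_\beta^\infty x^M e^{-(x^2+\alpha^2)/2}I_{M-1}(\alpha x)\,dx$ be the generalized Marcum $Q$-function. For $\kappa,\mu,\bar\gamma>0$, the $\kappa$-$\mu$ fading SNR law with these parameters is the law on $(0,\infty)$ with density $$f_{\kappa,\mu,\bar\gamma}(x)=\frac{\mu(1+\kappa)^{\frac{\mu+1}{2}}x^{\frac{\mu-1}{2}}e^{-\mu(1+\kappa)x/\bar\gamma}}{\kappa^{\frac{\mu-1}{2}}\bar\gamma^{\frac{\mu+1}{2}}e^{\mu\kappa}}\,I_{\mu-1}\!\left(2\mu\sqrt{\tfrac{\kappa(1+\kappa)x}{\bar\gamma}}\right).$$ Let $\kappa_M,\kappa_E,\bar\gamma_M,\bar\gamma_E>0$ be real, let $\mu_M,\mu_E$ be positive integers, and let $\gamma_M,\gamma_E$ be independent random variables whose laws are the $\kappa$-$\mu$ fading SNR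 laws with parameters $(\kappa_M,\mu_M,\bar\gamma_M)$ and $(\kappa_E,\mu_E,\bar\gamma_E)$. Let the secrecy capacity be $C_S=\log_2(1+\gamma_M)-\log_2(1+\gamma_E)$ if $\gamma_M>\gamma_E$ and $C_S=0$ otherwise. Put $a=1/\bar\gamma_M$, $b=1/\bar\gamma_E$, $$r=\sqrt{\frac{(1+\kappa_M)\mu_M a}{(1+\kappa_E)\mu_E b}},\quad R=r+r^{-1},\quad A=\sqrt{2\kappa_E\mu_E},\quad B=\sqrt{2\kappa_M\mu_M},\quad \mu=\mu_E-1,\quad v=\mu_M-1,$$ and, with $D=b(1+\kappa_E)\mu_E+a(1+\kappa_M)\mu_M$, $$P'=Q_1\!\left(\sqrt{\tfrac{2\kappa_E a\mu_E\mu_M(1+\kappa_M)}{D}},\sqrt{\tfrac{2\kappa_M b\mu_E\mu_M(1+\kappa_E)}{D}}\right)-\frac{b(1+\kappa_E)\mu_E}{D}\exp\!\left(-\frac{a\kappa_E\mu_M\mu_E(1+\kappa_M)+b\kappa_M\mu_M\mu_E(1+\kappa_E)}{D}\right)I_0\!\left(\frac{2\mu_E\mu_M\sqrt{ab\kappa_M\kappa_E(1+\kappa_E)(1+\kappa_M)}}{D}\right).$$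 Then the probability of strictly positive secrecy capacity $P_0=\Pr(C_S>0)=\Pr(\gamma_M>\gamma_E)$, and likewise the (convergent) integral $$\int_0^\infty f_{\kappa_E,\mu_E,\bar\gamma_E}(x)\,Q_{\mu_M}\!\left(\sqrt{2\kappa_M\mu_M},\sqrt{\tfrac{2(1+\kappa_M)\mu_M x}{\bar\gamma_M}}\right)dx,$$ is equal to $$1-P'-\exp\!\left(-\frac{A^2r+B^2r^{-1}}{2R}\right)\sum_{m=-\mu}^{v}\left(\frac{A}{Br}\right)^{m}I_m\!\left(\frac{AB}{R}\right)\left\{\sum_{k=1}^{\mu}\binom{v+k}{k+m}r^{v-k+1}R^{-v-k-1}-\sum_{j=1}^{v}\binom{j}{m}r^{j-1}R^{-j-1}\right\},$$ where $\binom{n}{k}=0$ unless $0\le k\le n$, and empty sums are $0$. -/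

import Mathlib

open MeasureTheory ProbabilityTheory Set

noncomputable section

/-- Modified Bessel function of the first kind of real order `ν`, by its power series
`I_ν(x) = (x/2)^ν ∑_k (x²/4)^k / (k! Γ(ν+k+1))`, for `x > 0` (and for all real `x` if `ν` is an
integer). At the poles of `Γ` Mathlib has `Real.Gamma = 0`, so that such a term is `0`, in agreement
with the usual convention `1 / Γ(-n) = 0`. -/
def besselI (ν x : ℝ) : ℝ :=
  (x / 2) ^ ν * ∑' k : ℕ, (x ^ 2 / 4) ^ k / ((k.factorial : ℝ) * Real.Gamma (ν + k + 1))

/-- Generalized Marcum `Q`-function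
`Q_M(α, β) = α^{-(M-1)} ∫_β^∞ x^M exp(-(x² + α²)/2) I_{M-1}(α x) dx`. -/
def marcumQ (M α β : ℝ) : ℝ :=
  1 / α ^ (M - 1) *
    ∫ x in Ioi β, x ^ M * Real.exp (-((x ^ 2 + α ^ 2) / 2)) * besselI (M - 1) (α * x)

/-- Probability density of the instantaneous SNR of a `κ`-`μ` fading channel with average SNR `g`;
it is supported on the positive half-line. -/
def kappaMuPDF (κ μ g x : ℝ) : ℝ :=
  if 0 < x then
    μ * (1 + κ) ^ ((μ + 1) / 2) * x ^ ((μ - 1) / 2) * Real.exp (-(μ * (1 + κ) * x) / g) /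
        (κ ^ ((μ - 1) / 2) * g ^ ((μ + 1) / 2) * Real.exp (μ * κ)) *
      besselI (μ - 1) (2 * μ * √(κ * (1 + κ) * x / g))
  else 0

/-- The law of the instantaneous SNR of a `κ`-`μ` fading channel with average SNR `g`. -/
def kappaMuLaw (κ μ g : ℝ) : Measure ℝ :=
  volume.withDensity fun x => ENNReal.ofReal (kappaMuPDF κ μ g x)

/-- Secrecy capacity for a realization `(x, y)` of the SNRs of the main channel and of the
eavesdropper's channel. -/
def secrecyCapacity (x y : ℝ) : ℝ :=
  if y < x then Real.logb 2 (1 + x) - Real.logb 2 (1 + y) else 0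

/-- The integrand of the integral representation of the probability of strictly positive secrecy
capacity: the density of the eavesdropper's SNR at `x` times the probability (a Marcum
`Q`-function) that the SNR of the main channel exceeds `x`. -/
def spscIntegrand (κM μM gM κE μE gE x : ℝ) : ℝ :=
  kappaMuPDF κE μE gE x * marcumQ μM √(2 * κM * μM) √(2 * (1 + κM) * μM * x / gM)

/-- Binomial coefficient with an integer lower entry; it is `0` unless `0 ≤ k ≤ n`. -/
def intChoose (n : ℕ) (k : ℤ) : ℕ :=
  if 0 ≤ k then n.choose k.toNat else 0

/-- The term `P'` of the closed form, where `a` and `b` are the reciprocals of the average SNRs of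
the main channel and of the eavesdropper's channel. -/
def spscPPrime (κM μM a κE μE b : ℝ) : ℝ :=
  marcumQ 1
      √(2 * κE * a * μE * μM * (1 + κM) / (b * (1 + κE) * μE + a * (1 + κM) * μM))
      √(2 * κM * b * μE * μM * (1 + κE) / (b * (1 + κE) * μE + a * (1 + κM) * μM)) -
    b * (1 + κE) * μE / (b * (1 + κE) * μE + a * (1 + κM) * μM) *
      Real.exp (-((a * κE * μM * μE * (1 + κM) + b * κM * μM * μE * (1 + κE)) /
        (b * (1 + κE) * μE + a * (1 + κM) * μM))) *
      besselI 0 (2 * μE * μM * √(a * b * κM * κE * (1 + κE) * (1 + κM)) /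
        (b * (1 + κE) * μE + a * (1 + κM) * μM))

/-- The exponential times the finite double sum of the closed form. -/
def spscSum (μ v : ℕ) (A B r R : ℝ) : ℝ :=
  Real.exp (-((A ^ 2 * r + B ^ 2 * r⁻¹) / (2 * R))) *
    ∑ m ∈ Finset.Icc (-(μ : ℤ)) (v : ℤ), (A / (B * r)) ^ m * besselI (m : ℝ) (A * B / R) *
      ((∑ k ∈ Finset.Icc 1 μ, (intChoose (v + k) (k + m) : ℝ) *
          r ^ ((v : ℤ) - k + 1) * R ^ (-(v : ℤ) - k - 1)) -
        ∑ j ∈ Finset.Icc 1 v, (intChoose j m : ℝ) *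
          r ^ ((j : ℤ) - 1) * R ^ (-(j : ℤ) - 1))

end

/-! For integer `μ`, a `κ`-`μ` variable is an Erlang variable of random shape `μ + J`, with `J`
Poisson of mean `κμ` and rate `(1 + κ)μ/g`. This is the Bessel series read as a Poisson mixture
(`hasSum_kappaMuPDF`); integrating it termwise shows that its tails are Marcum functions.

Let `c` and `d` be the rates of the main and eavesdropper channels, and `J`, `K` their Poisson
variables. Given `J` and `K`, the two SNRs are the arrival times of the `(v+1+J)`-th and
`(μ+1+K)`-th points of independent Poisson processes. Each point of the merged process belongs to
the main channel with probability `q = c/(c+d)`. Hence the main SNR is the smaller one exactly when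
at least `v+1+J` of the first `v+μ+1+J+K` points are of main type: a binomial tail
(`integral_poissonWeight_mul_poissonCDF`).

Now average over `J` and `K`. Each of the `K` extra trials lowers the threshold upon success; each
of the `J` extra trials comes with a threshold raised by one, so it costs one upon failure. By
thinning (`tsum_tsum_binTail`), what remains is the tail for `v+μ+1` trials at threshold `v+1-l`,
where `l = j-i` is a difference of independent Poisson variables of means `y = κE μE q` and `x = κM
μM (1-q)`. The law of `l` has weights `exp(-(x+y)) (y/x)^(l/2) I_l(2√(xy))`.

Finally `binTail_eq_add_skellamCoeff` reduces that tail to one trial at threshold `1-l`, plus a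
correction vanishing unless `-μ ≤ l ≤ v`. The one-trial tail is `1[l ≥ 0] - (1-q) 1[l = 0]`, whose
mean is `P'`; the correction gives the finite Bessel sum. The substitution `q = r/R` puts it in the
stated form. -/

/-! ### Poisson weights and thinning -/

/-- The weight of `k` under the Poisson law of mean `c`. -/
noncomputable def poissonWeight (c : ℝ) (k : ℕ) : ℝ := Real.exp (-c) * c ^ k / k.factorial

lemma poissonWeight_nonneg {c : ℝ} (hc : 0 ≤ c) (k : ℕ) : 0 ≤ poissonWeight c k := by
  unfold poissonWeight; positivity

lemma hasSum_poissonWeight (c : ℝ) : HasSum (poissonWeight c) 1 := by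
  have h := (NormedSpace.expSeries_div_hasSum_exp c).mul_left (Real.exp (-c))
  rw [← congrFun Real.exp_eq_exp_ℝ c, ← Real.exp_add, neg_add_cancel, Real.exp_zero] at h
  have e : poissonWeight c = fun k => Real.exp (-c) * (c ^ k / k.factorial) :=
    funext fun k => mul_div_assoc _ _ _
  rwa [e]

lemma summable_poissonWeight_mul {c : ℝ} (hc : 0 ≤ c) {g : ℕ → ℝ} (hg : ∀ i, |g i| ≤ 1) :
    Summable fun i => poissonWeight c i * g i := by
  refine Summable.of_norm_bounded (hasSum_poissonWeight c).summable fun i => ?_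
  rw [Real.norm_eq_abs, abs_mul, abs_of_nonneg (poissonWeight_nonneg hc i)]
  exact mul_le_of_le_one_right (poissonWeight_nonneg hc i) (hg i)

lemma abs_tsum_poissonWeight_mul_le {c : ℝ} (hc : 0 ≤ c) {g : ℕ → ℝ} (hg : ∀ i, |g i| ≤ 1) :
    |∑' i, poissonWeight c i * g i| ≤ 1 := by
  rw [← Real.norm_eq_abs]
  refine tsum_of_norm_bounded (hasSum_poissonWeight c) fun i => ?_
  rw [Real.norm_eq_abs, abs_mul, abs_of_nonneg (poissonWeight_nonneg hc i)]
  exact mul_le_of_le_one_right (poissonWeight_nonneg hc i) (hg i)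

/-- Thinning of a Poisson variable. -/
lemma tsum_poissonWeight_thinning {c p q : ℝ} (hc : 0 ≤ c) (hp : 0 ≤ p)
    (h : q + p = 1) {g : ℕ → ℝ} (hg : ∀ i, |g i| ≤ 1) :
    ∑' n, poissonWeight c n *
        ∑ i ∈ Finset.range (n + 1), (n.choose i : ℝ) * (p ^ i * q ^ (n - i) * g i) =
      ∑' i, poissonWeight (c * p) i * g i := by
  have h1 : Summable fun i => ‖poissonWeight (c * p) i * g i‖ :=
    (summable_poissonWeight_mul (by positivity) hg).norm
  have h2 : Summable fun i => ‖poissonWeight (c * q) i‖ :=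
    (hasSum_poissonWeight _).summable.norm
  -- The second series, of mean `c * q`, has sum `1`, so multiplying by it is free; the Cauchy
  -- product groups the pairs by their total `n`.
  have h3 := tsum_mul_tsum_eq_tsum_sum_range_of_summable_norm h1 h2
  rw [(hasSum_poissonWeight (c * q)).tsum_eq, mul_one] at h3
  rw [h3]
  refine tsum_congr fun n => ?_
  rw [Finset.mul_sum]
  refine Finset.sum_congr rfl fun i hi => ?_
  have hin : i ≤ n := Nat.lt_succ_iff.mp (Finset.mem_range.mp hi)
  have he : Real.exp (-c) = Real.exp (-(c * p)) * Real.exp (-(c * q)) := by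
    rw [← Real.exp_add]; congr 1; linear_combination c * h
  have hcn : c ^ n = c ^ i * c ^ (n - i) := by rw [← pow_add, Nat.add_sub_cancel' hin]
  unfold poissonWeight
  rw [Nat.cast_choose ℝ hin, he, hcn, mul_pow, mul_pow]
  have := n.factorial_ne_zero
  field_simp

/-- The recurrence is one step of a walk that jumps by `d` with weight `p` and stays with weight
`q`; after `k` steps the number of jumps carries binomial weights. -/
lemma binomial_iterate {p q : ℝ} {f : ℕ → ℤ → ℝ} {d : ℤ}
    (h : ∀ k t, f (k + 1) t = q * f k t + p * f k (t + d)) (k : ℕ) (t : ℤ) :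
    f k t = ∑ i ∈ Finset.range (k + 1),
      (k.choose i : ℝ) * (p ^ i * q ^ (k - i) * f 0 (t + d * i)) := by
  induction k generalizing t with
  | zero => simp
  | succ k ih =>
    rw [Finset.sum_choose_succ_mul (fun i j => p ^ i * q ^ j * f 0 (t + d * i)) k, h, ih, ih,
      Finset.mul_sum, Finset.mul_sum]
    congr 1 <;> refine Finset.sum_congr rfl fun i hi => ?_
    · rw [Nat.succ_sub (Nat.lt_succ_iff.mp (Finset.mem_range.mp hi)), pow_succ]; ring
    · push_cast
      rw [show t + d + d * i = t + d * (i + 1) by ring, pow_succ]; ring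

/-! ### Binomial tails -/

/-- The probability that a binomial variable with `N` trials and success probability `q` is at
least `t`. -/
noncomputable def binTail (q : ℝ) : ℕ → ℤ → ℝ
  | 0, t => if t ≤ 0 then 1 else 0
  | N + 1, t => q * binTail q N (t - 1) + (1 - q) * binTail q N t

lemma binTail_nonneg {q : ℝ} (h0 : 0 ≤ q) (h1 : q ≤ 1) (N : ℕ) (t : ℤ) : 0 ≤ binTail q N t := by
  induction N generalizing t with
  | zero => unfold binTail; split_ifs <;> norm_num
  | succ N ih =>
    have := ih t
    have := ih (t - 1)
    have : 0 ≤ 1 - q := by linarith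
    rw [binTail]; positivity

lemma binTail_le_one {q : ℝ} (h0 : 0 ≤ q) (h1 : q ≤ 1) (N : ℕ) (t : ℤ) : binTail q N t ≤ 1 := by
  induction N generalizing t with
  | zero => unfold binTail; split_ifs <;> norm_num
  | succ N ih =>
    rw [binTail]
    nlinarith [ih t, ih (t - 1)]

lemma abs_binTail_le_one {q : ℝ} (h0 : 0 ≤ q) (h1 : q ≤ 1) (N : ℕ) (t : ℤ) :
    |binTail q N t| ≤ 1 := by
  rw [abs_of_nonneg (binTail_nonneg h0 h1 N t)]; exact binTail_le_one h0 h1 N t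

lemma binTail_of_nonpos {q : ℝ} (N : ℕ) {t : ℤ} (ht : t ≤ 0) : binTail q N t = 1 := by
  induction N generalizing t with
  | zero => simp [binTail, ht]
  | succ N ih => rw [binTail, ih ht, ih (by omega)]; ring

lemma intChoose_succ (n : ℕ) (k : ℤ) :
    intChoose (n + 1) k = intChoose n (k - 1) + intChoose n k := by
  unfold intChoose
  rcases lt_trichotomy k 0 with hk | rfl | hk
  · simp [show ¬ 0 ≤ k by omega, show ¬ 1 ≤ k by omega]
  · simp
  · obtain ⟨m, rfl⟩ : ∃ m : ℕ, k = m + 1 := ⟨(k - 1).toNat, by omega⟩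
    have h : ((m : ℤ) + 1).toNat = m + 1 := by omega
    have h' : (0 : ℤ) ≤ (m : ℤ) + 1 := by omega
    simp [h, h', Nat.choose_succ_succ]

lemma intChoose_symm {n : ℕ} {k l : ℤ} (h : k + l = n) : intChoose n k = intChoose n l := by
  unfold intChoose
  split_ifs with hk hl hl
  · rw [← Nat.choose_symm_of_eq_add (show n = k.toNat + l.toNat by omega)]
  · exact Nat.choose_eq_zero_of_lt (by omega)
  · exact (Nat.choose_eq_zero_of_lt (by omega)).symm
  · rfl

lemma intChoose_natCast (n k : ℕ) : intChoose n (k : ℤ) = n.choose k := by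
  simp [intChoose]

lemma intChoose_of_neg (n : ℕ) {k : ℤ} (h : k < 0) : intChoose n k = 0 := by
  simp [intChoose, h]

lemma intChoose_of_gt (n : ℕ) {k : ℤ} (h : (n : ℤ) < k) : intChoose n k = 0 := by
  rw [intChoose, if_pos (by omega)]
  exact Nat.choose_eq_zero_of_lt (by omega)

/-- The point mass at `t`. Integer exponents and `intChoose` let one formula cover thresholds
outside `0..N`, where it vanishes. -/
lemma binTail_sub_succ {q : ℝ} (h0 : 0 < q) (h1 : q < 1) (N : ℕ) (t : ℤ) :
    binTail q N t - binTail q N (t + 1) =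
      (intChoose N t : ℝ) * (q ^ t * (1 - q) ^ ((N : ℤ) - t)) := by
  have hp : 1 - q ≠ 0 := by linarith
  induction N generalizing t with
  | zero =>
    rcases lt_trichotomy t 0 with ht | rfl | ht
    · simp [binTail, intChoose_of_neg 0 ht, ht.le, show t + 1 ≤ 0 by omega]
    · simp [binTail, intChoose]
    · simp [binTail, intChoose_of_gt 0 (show ((0 : ℕ) : ℤ) < t by simpa), ht,
        show ¬ t + 1 ≤ 0 by omega]
  | succ N ih =>
    have e1 := ih t
    have e2 := ih (t - 1)
    rw [sub_add_cancel, zpow_sub_one₀ h0.ne',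
      show (N : ℤ) - (t - 1) = ((N : ℤ) - t) + 1 by ring, zpow_add_one₀ hp] at e2
    have h2 : q * q⁻¹ = 1 := mul_inv_cancel₀ h0.ne'
    rw [binTail, binTail, intChoose_succ, add_sub_cancel_right,
      show ((N + 1 : ℕ) : ℤ) - t = ((N : ℤ) - t) + 1 by push_cast; ring, zpow_add_one₀ hp]
    push_cast
    linear_combination q * e2 + (1 - q) * e1 + (intChoose N (t - 1) : ℝ) * q ^ t *
      ((1 - q) ^ ((N : ℤ) - t) * (1 - q)) * h2

/-- One more trial, same threshold. -/
lemma binTail_succ_left {q : ℝ} (h0 : 0 < q) (h1 : q < 1) (N : ℕ) (t : ℤ) :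
    binTail q (N + 1) t = binTail q N t +
      (intChoose N (t - 1) : ℝ) * (q ^ t * (1 - q) ^ ((N : ℤ) + 1 - t)) := by
  have h := binTail_sub_succ h0 h1 N (t - 1)
  rw [sub_add_cancel, zpow_sub_one₀ h0.ne', show (N : ℤ) - (t - 1) = (N : ℤ) + 1 - t by ring] at h
  have h2 : q * q⁻¹ = 1 := mul_inv_cancel₀ h0.ne'
  rw [binTail]
  linear_combination q * h + (intChoose N (t - 1) : ℝ) * q ^ t * (1 - q) ^ ((N : ℤ) + 1 - t) * h2

/-- One more trial, threshold raised by one. -/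
lemma binTail_succ_succ {q : ℝ} (h0 : 0 < q) (h1 : q < 1) (N : ℕ) (t : ℤ) :
    binTail q (N + 1) (t + 1) = binTail q N t -
      (intChoose N t : ℝ) * (q ^ t * (1 - q) ^ ((N : ℤ) - t + 1)) := by
  have h := binTail_sub_succ h0 h1 N t
  rw [binTail, add_sub_cancel_right, zpow_add_one₀ (by linarith)]
  linear_combination -(1 - q) * h

/-- The summands are negative binomial weights: fewer than `m` successes precede the `(n+1)`-th
failure iff the first `m + n` trials contain fewer than `m` successes. -/
lemma sum_choose_eq_one_sub_binTail {q : ℝ} (h0 : 0 < q) (h1 : q < 1) (m n : ℕ) :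
    ∑ i ∈ Finset.range m, ((n + i).choose i : ℝ) * ((1 - q) ^ (n + 1) * q ^ i) =
      1 - binTail q (m + n) m := by
  induction m with
  | zero => simp [binTail_of_nonpos]
  | succ m ih =>
    have h := binTail_succ_succ h0 h1 (m + n) m
    rw [Finset.sum_range_succ, ih, show m + 1 + n = m + n + 1 by ring, Nat.cast_succ, h,
      intChoose_natCast, show ((m + n : ℕ) : ℤ) - m + 1 = ((n + 1 : ℕ) : ℤ) by push_cast; ring,
      zpow_natCast, zpow_natCast, add_comm n m]
    ring

/-- The coefficient of the Skellam weight at `l` in the expansion of the binomial tail. -/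
noncomputable def skellamCoeff (q : ℝ) (μ v : ℕ) (l : ℤ) : ℝ :=
  (∑ k ∈ Finset.Icc 1 μ, (intChoose (v + k) (k + l) : ℝ) *
      (q ^ ((v : ℤ) + 1 - l) * (1 - q) ^ ((k : ℤ) + l))) -
    ∑ j ∈ Finset.Icc 1 v, (intChoose j l : ℝ) * (q ^ ((j : ℤ) - l) * (1 - q) ^ (l + 1))

/-- Telescope from one trial at threshold `1 - l`: `v` steps raise trials and threshold together
(the `j`-sum), then `μ` steps add trials only (the `k`-sum). -/
lemma binTail_eq_add_skellamCoeff {q : ℝ} (h0 : 0 < q) (h1 : q < 1) (μ v : ℕ) (l : ℤ) :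
    binTail q (v + μ + 1) ((v : ℤ) + 1 - l) = binTail q 1 (1 - l) + skellamCoeff q μ v l := by
  have hv : ∀ v : ℕ, binTail q (v + 1) ((v : ℤ) + 1 - l) = binTail q 1 (1 - l) -
      ∑ j ∈ Finset.Icc 1 v, (intChoose j l : ℝ) * (q ^ ((j : ℤ) - l) * (1 - q) ^ (l + 1)) := by
    intro v
    induction v with
    | zero => simp
    | succ v ih =>
      have h := binTail_succ_succ h0 h1 (v + 1) ((v : ℤ) + 1 - l)
      rw [intChoose_symm (show ((v : ℤ) + 1 - l) + l = ((v + 1 : ℕ) : ℤ) by push_cast; ring)] at h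
      rw [Finset.sum_Icc_succ_top (by omega),
        show (((v + 1 : ℕ) : ℤ) + 1 - l) = (v : ℤ) + 1 - l + 1 by push_cast; ring, h, ih,
        show ((v + 1 : ℕ) : ℤ) - ((v : ℤ) + 1 - l) + 1 = l + 1 by push_cast; ring,
        show (((v + 1 : ℕ) : ℤ) - l) = (v : ℤ) + 1 - l by push_cast; ring]
      ring
  have hμ : ∀ μ : ℕ, binTail q (v + μ + 1) ((v : ℤ) + 1 - l) = binTail q (v + 1) ((v : ℤ) + 1 - l) +
      ∑ k ∈ Finset.Icc 1 μ, (intChoose (v + k) (k + l) : ℝ) *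
        (q ^ ((v : ℤ) + 1 - l) * (1 - q) ^ ((k : ℤ) + l)) := by
    intro μ
    induction μ with
    | zero => simp
    | succ μ ih =>
      have h := binTail_succ_left h0 h1 (v + μ + 1) ((v : ℤ) + 1 - l)
      rw [intChoose_symm (show ((v : ℤ) + 1 - l - 1) + ((μ + 1 : ℕ) + l) = ((v + μ + 1 : ℕ) : ℤ) by
        push_cast; ring)] at h
      rw [Finset.sum_Icc_succ_top (by omega), ← add_assoc v μ 1, h, ih,
        show ((v + μ + 1 : ℕ) : ℤ) + 1 - ((v : ℤ) + 1 - l) = ((μ + 1 : ℕ) : ℤ) + l by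
          push_cast; ring]
      ring
  rw [hμ, hv, skellamCoeff]
  ring

lemma skellamCoeff_eq_zero (q : ℝ) {μ v : ℕ} {l : ℤ} (hl : l ∉ Finset.Icc (-(μ : ℤ)) (v : ℤ)) :
    skellamCoeff q μ v l = 0 := by
  rw [Finset.mem_Icc, not_and_or, not_le, not_le] at hl
  unfold skellamCoeff
  rw [Finset.sum_eq_zero, Finset.sum_eq_zero, sub_zero]
  · intro j hj
    rw [Finset.mem_Icc] at hj
    rcases hl with hl | hl
    · rw [intChoose_of_neg _ (by omega)]; simp
    · rw [intChoose_of_gt _ (by omega)]; simp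
  · intro k hk
    rw [Finset.mem_Icc] at hk
    rcases hl with hl | hl
    · rw [intChoose_of_neg _ (by omega)]; simp
    · rw [intChoose_of_gt _ (by push_cast; omega)]; simp

/-- Poisson mixtures of binomial tails, in terms of thinned Poisson variables. -/
lemma tsum_tsum_binTail {q c d : ℝ} (h0 : 0 ≤ q) (h1 : q ≤ 1) (hc : 0 ≤ c) (hd : 0 ≤ d)
    (N : ℕ) (t : ℤ) :
    ∑' J, poissonWeight c J * ∑' K, poissonWeight d K * binTail q (N + J + K) (t + J) =
      ∑' i, poissonWeight (c * (1 - q)) i *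
        ∑' j, poissonWeight (d * q) j * binTail q N (t + i - j) := by
  have hp : 0 ≤ 1 - q := by linarith
  have hb := abs_binTail_le_one h0 h1
  have inner : ∀ (N : ℕ) (t : ℤ), ∑' K, poissonWeight d K * binTail q (N + K) t =
      ∑' j, poissonWeight (d * q) j * binTail q N (t - j) := by
    intro N t
    rw [← tsum_poissonWeight_thinning (q := 1 - q) hd h0 (by ring) fun j => hb N (t - j)]
    refine tsum_congr fun K => ?_
    -- Each extra trial lowers the remaining threshold by one with probability `q`.
    rw [binomial_iterate (p := q) (q := 1 - q) (f := fun k t => binTail q (N + k) t) (d := -1)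
      (fun k t => by
        change binTail q (N + k + 1) t = _
        rw [binTail]; ring_nf) K t]
    simp only [neg_one_mul, ← sub_eq_add_neg, add_zero]
  set G : ℕ → ℤ → ℝ := fun N t => ∑' j, poissonWeight (d * q) j * binTail q N (t - j) with hG
  have hGb : ∀ N t, |G N t| ≤ 1 := fun N t =>
    abs_tsum_poissonWeight_mul_le (by positivity) fun j => hb N (t - j)
  have hGs : ∀ N t, Summable fun j => poissonWeight (d * q) j * binTail q N (t - (j : ℤ)) :=
    fun N t => summable_poissonWeight_mul (by positivity) fun j => hb N (t - j)
  have hGrec : ∀ N t, G (N + 1) t = q * G N (t - 1) + (1 - q) * G N t := by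
    intro N t
    simp only [hG]
    rw [← tsum_mul_left, ← tsum_mul_left,
      ← ((hGs N (t - 1)).mul_left q).tsum_add ((hGs N t).mul_left (1 - q))]
    refine tsum_congr fun j => ?_
    rw [binTail, show t - (j : ℤ) - 1 = t - 1 - j by ring]
    ring
  simp_rw [inner]
  change ∑' J, poissonWeight c J * G (N + J) (t + J) =
    ∑' i, poissonWeight (c * (1 - q)) i * G N (t + i)
  rw [← tsum_poissonWeight_thinning (q := q) hc hp (by ring) fun i => hGb N (t + i)]
  refine tsum_congr fun J => ?_
  -- Along this diagonal trials and threshold grow together, so a success leaves the remaining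
  -- threshold unchanged and a failure raises it by one.
  rw [binomial_iterate (p := 1 - q) (q := q) (f := fun k t => G (N + k) (t + k)) (d := 1)
    (fun k t => by
      change G (N + k + 1) (t + (k + 1 : ℕ)) = _
      rw [hGrec]; push_cast; ring_nf) J t]
  simp

/-! ### Differences of Poisson variables and Bessel functions -/

lemma poissonWeight_le_one {c : ℝ} (hc : 0 ≤ c) (k : ℕ) : poissonWeight c k ≤ 1 :=
  le_hasSum (hasSum_poissonWeight c) k fun i _ => poissonWeight_nonneg hc i

/-- The Poisson weight, extended by zero to the integers. -/
noncomputable def poissonWeightInt (c : ℝ) (l : ℤ) : ℝ :=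
  if 0 ≤ l then poissonWeight c l.toNat else 0

lemma poissonWeightInt_natCast (c : ℝ) (n : ℕ) : poissonWeightInt c n = poissonWeight c n := by
  simp [poissonWeightInt]

lemma abs_poissonWeightInt_le_one {c : ℝ} (hc : 0 ≤ c) (l : ℤ) : |poissonWeightInt c l| ≤ 1 := by
  unfold poissonWeightInt
  split_ifs
  · rw [abs_of_nonneg (poissonWeight_nonneg hc _)]; exact poissonWeight_le_one hc _
  · simp

/-- The law of the difference of two independent Poisson variables. -/
lemma hasSum_skellam {x y : ℝ} (hx : 0 < x) (hy : 0 < y) (l : ℤ) :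
    HasSum (fun i : ℕ => poissonWeight x i * poissonWeightInt y (i + l))
      (Real.exp (-(x + y)) * √(y / x) ^ l * besselI l (2 * √(x * y))) := by
  have hs := summable_poissonWeight_mul hx.le
    (g := fun i => poissonWeightInt y (i + l)) fun i => abs_poissonWeightInt_le_one hy.le _
  convert hs.hasSum using 1
  rw [besselI, ← mul_assoc, ← tsum_mul_left]
  refine tsum_congr fun i => ?_
  rw [show 2 * √(x * y) / 2 = √(x * y) by ring,
    show (2 * √(x * y)) ^ 2 / 4 = x * y by rw [mul_pow, Real.sq_sqrt (by positivity)]; ring,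
    Real.rpow_intCast, mul_assoc (Real.exp _), ← mul_zpow, ← Real.sqrt_mul (by positivity),
    show y / x * (x * y) = y ^ 2 by field_simp, Real.sqrt_sq hy.le]
  unfold poissonWeightInt
  split_ifs with h
  · obtain ⟨n, hn⟩ := Int.eq_ofNat_of_zero_le h
    have hn' : (l : ℝ) + i + 1 = n + 1 := by
      have : ((i + l : ℤ) : ℝ) = n := by rw [hn]; simp
      push_cast at this; linarith
    have hl : y ^ l * y ^ i = y ^ n := by
      rw [← zpow_natCast, ← zpow_add₀ hy.ne', add_comm, hn, zpow_natCast]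
    rw [hn', Real.Gamma_nat_eq_factorial, hn, Int.toNat_natCast, poissonWeight, poissonWeight,
      mul_pow, neg_add, Real.exp_add, ← hl]
    have := i.factorial_ne_zero
    have := n.factorial_ne_zero
    field_simp
  -- Here `i + l < 0`, so the Bessel term sits at a pole of `Γ`; there `Real.Gamma` is `0` and
  -- division by zero gives `0`, matching `poissonWeightInt`.
  · obtain ⟨n, hn⟩ : ∃ n : ℕ, (i : ℤ) + l + 1 = -n := ⟨(-(i + l + 1)).toNat, by omega⟩
    have hn' : (l : ℝ) + i + 1 = -n := by
      have : ((i + l + 1 : ℤ) : ℝ) = (-n : ℤ) := by rw [hn]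
      push_cast at this; linarith
    rw [hn', Real.Gamma_neg_nat_eq_zero]
    simp

lemma hasSum_skellam_nat {x y : ℝ} (hx : 0 < x) (hy : 0 < y) (n : ℕ) :
    HasSum (fun i : ℕ => poissonWeight x i * poissonWeight y (n + i))
      (Real.exp (-(x + y)) * √(y / x) ^ n * besselI n (2 * √(x * y))) := by
  have h := hasSum_skellam hx hy n
  simp only [zpow_natCast, Int.cast_natCast] at h
  convert h using 3 with i
  rw [← poissonWeightInt_natCast, Nat.cast_add, add_comm]

/-! ### Termwise integration and Erlang tails -/

lemma HasSum.of_forall_eq {f g : ℕ → ℝ} {a b : ℝ} (h : HasSum f a) (hfg : ∀ i, g i = f i)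
    (hab : b = a) : HasSum g b := by
  rwa [hab, show g = f from funext hfg]

/-- Termwise integration of a series of nonnegative functions. -/
lemma integrableOn_and_hasSum_of_nonneg {s : Set ℝ} (hs : MeasurableSet s) {F : ℕ → ℝ → ℝ}
    {f : ℝ → ℝ} {c : ℕ → ℝ} (hF : ∀ i, IntegrableOn (F i) s) (h0 : ∀ i, ∀ x ∈ s, 0 ≤ F i x)
    (hc : ∀ i, ∫ x in s, F i x = c i) (hcs : Summable c)
    (hf : ∀ x ∈ s, HasSum (fun i => F i x) (f x)) :
    IntegrableOn f s ∧ HasSum c (∫ x in s, f x) := by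
  have hn : ∀ i, ∫ x in s, ‖F i x‖ = c i := fun i => by
    rw [← hc i]
    exact setIntegral_congr_fun hs fun x hx => Real.norm_of_nonneg (h0 i x hx)
  constructor
  -- As a pointwise limit of partial sums `f` is measurable, which avoids any regularity argument
  -- for `besselI`.
  · have hm : AEStronglyMeasurable f (volume.restrict s) :=
      aestronglyMeasurable_of_tendsto_ae Filter.atTop
        (f := fun n x => ∑ i ∈ Finset.range n, F i x)
        (fun n => Finset.aestronglyMeasurable_fun_sum _ fun i _ => (hF i).1)
        ((ae_restrict_iff' hs).2 <| .of_forall fun x hx => (hf x hx).tendsto_sum_nat)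
    refine ⟨hm, ?_⟩
    rw [hasFiniteIntegral_iff_ofReal ((ae_restrict_iff' hs).2 <| .of_forall fun x hx =>
      (hf x hx).nonneg fun i => h0 i x hx)]
    have h1 : ∫⁻ x in s, ENNReal.ofReal (f x) = ∫⁻ x in s, ∑' i, ENNReal.ofReal (F i x) :=
      setLIntegral_congr_fun hs fun x hx => by
        rw [← (hf x hx).tsum_eq, ENNReal.ofReal_tsum_of_nonneg (fun i => h0 i x hx)
          (hf x hx).summable]
    have h2 : ∀ i, ∫⁻ x in s, ENNReal.ofReal (F i x) = ENNReal.ofReal (c i) := fun i => by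
      rw [← hc i, ofReal_integral_eq_lintegral_ofReal (hF i)
        ((ae_restrict_iff' hs).2 <| .of_forall (h0 i))]
    have hc0 : ∀ i, 0 ≤ c i := fun i => by rw [← hc i]; exact setIntegral_nonneg hs (h0 i)
    rw [h1, lintegral_tsum fun i => (hF i).1.aemeasurable.ennreal_ofReal, tsum_congr h2,
      ← ENNReal.ofReal_tsum_of_nonneg hc0 hcs]
    exact ENNReal.ofReal_lt_top
  · have h := hasSum_integral_of_summable_integral_norm hF (by simpa only [hn] using hcs)
    simp only [hc] at h
    rwa [setIntegral_congr_fun hs fun x hx => (hf x hx).tsum_eq] at h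

/-- The probability that a Poisson variable of mean `c` is less than `m`. -/
noncomputable def poissonCDF (m : ℕ) (c : ℝ) : ℝ := ∑ i ∈ Finset.range m, poissonWeight c i

lemma poissonCDF_nonneg (m : ℕ) {c : ℝ} (hc : 0 ≤ c) : 0 ≤ poissonCDF m c :=
  Finset.sum_nonneg fun i _ => poissonWeight_nonneg hc i

lemma poissonCDF_le_one (m : ℕ) {c : ℝ} (hc : 0 ≤ c) : poissonCDF m c ≤ 1 :=
  sum_le_hasSum _ (fun i _ => poissonWeight_nonneg hc i) (hasSum_poissonWeight c)

lemma abs_poissonCDF_le_one (m : ℕ) {c : ℝ} (hc : 0 ≤ c) : |poissonCDF m c| ≤ 1 := by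
  rw [abs_of_nonneg (poissonCDF_nonneg m hc)]; exact poissonCDF_le_one m hc

lemma poissonCDF_succ_zero (m : ℕ) : poissonCDF (m + 1) 0 = 1 := by
  rw [poissonCDF, Finset.sum_range_succ']
  simp [poissonWeight]

lemma hasDerivAt_poissonCDF (m : ℕ) (c : ℝ) :
    HasDerivAt (poissonCDF (m + 1)) (-poissonWeight c m) c := by
  have he : HasDerivAt (fun c : ℝ => Real.exp (-c)) (-Real.exp (-c)) c := by
    simpa using (hasDerivAt_neg c).exp
  induction m with
  | zero =>
    have : poissonCDF (0 + 1) = fun c => Real.exp (-c) := by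
      funext c; simp [poissonCDF, poissonWeight]
    rw [this]
    simpa [poissonWeight] using he
  | succ m ih =>
    have hw : HasDerivAt (fun c => poissonWeight c (m + 1))
        (poissonWeight c m - poissonWeight c (m + 1)) c := by
      have h := (he.mul (hasDerivAt_pow (m + 1) c)).div_const ((m + 1).factorial : ℝ)
      refine h.congr_deriv ?_
      unfold poissonWeight
      rw [Nat.factorial_succ]
      have := m.factorial_ne_zero
      push_cast
      field_simp
      ring
    have : poissonCDF (m + 1 + 1) = fun c => poissonCDF (m + 1) c + poissonWeight c (m + 1) := by
      funext c; simp only [poissonCDF, Finset.sum_range_succ]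
    rw [this]
    exact (ih.add hw).congr_deriv (by ring)

lemma tendsto_poissonCDF_atTop (m : ℕ) :
    Filter.Tendsto (poissonCDF m) Filter.atTop (nhds 0) := by
  have h : ∀ i ∈ Finset.range m,
      Filter.Tendsto (fun c => poissonWeight c i) Filter.atTop (nhds 0) := fun i _ => by
    have := (Real.tendsto_pow_mul_exp_neg_atTop_nhds_zero i).div_const (i.factorial : ℝ)
    rw [zero_div] at this
    refine this.congr fun c => ?_
    rw [poissonWeight, mul_comm]
  have h' := tendsto_finsetSum _ h
  rwa [Finset.sum_const_zero] at h'

/-- `-poissonCDF (m + 1) ∘ φ` is an antiderivative vanishing at infinity. Taking `φ` linear serves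
the Erlang densities, `φ = x²/2` the Marcum integral. -/
lemma integral_Ioi_deriv_mul_poissonWeight {φ φ' : ℝ → ℝ} {b : ℝ}
    (hφ : ∀ x ∈ Ici b, HasDerivAt φ (φ' x) x) (h0 : ∀ x ∈ Ioi b, 0 ≤ φ x)
    (h0' : ∀ x ∈ Ioi b, 0 ≤ φ' x) (hlim : Filter.Tendsto φ Filter.atTop Filter.atTop) (m : ℕ) :
    IntegrableOn (fun x => φ' x * poissonWeight (φ x) m) (Ioi b) ∧
      ∫ x in Ioi b, φ' x * poissonWeight (φ x) m = poissonCDF (m + 1) (φ b) := by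
  have hd : ∀ x ∈ Ici b, HasDerivAt (fun x => -poissonCDF (m + 1) (φ x))
      (φ' x * poissonWeight (φ x) m) x := fun x hx =>
    ((hasDerivAt_poissonCDF m (φ x)).comp x (hφ x hx)).neg.congr_deriv (by ring)
  have hnn : ∀ x ∈ Ioi b, 0 ≤ φ' x * poissonWeight (φ x) m := fun x hx =>
    mul_nonneg (h0' x hx) (poissonWeight_nonneg (h0 x hx) m)
  have ht := ((tendsto_poissonCDF_atTop (m + 1)).comp hlim).neg
  refine ⟨integrableOn_Ioi_deriv_of_nonneg' hd hnn ht, ?_⟩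
  rw [integral_Ioi_of_hasDerivAt_of_nonneg' hd hnn ht]
  ring

lemma integral_Ioi_poissonWeight {c b : ℝ} (hc : 0 < c) (hb : 0 ≤ b) (m : ℕ) :
    IntegrableOn (fun x => c * poissonWeight (c * x) m) (Ioi b) ∧
      ∫ x in Ioi b, c * poissonWeight (c * x) m = poissonCDF (m + 1) (c * b) :=
  integral_Ioi_deriv_mul_poissonWeight (φ := fun x => c * x) (φ' := fun _ => c)
    (fun x _ => by simpa using (hasDerivAt_id x).const_mul c)
    (fun x hx => mul_nonneg hc.le (hb.trans (le_of_lt hx))) (fun _ _ => hc.le)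
    (Filter.tendsto_id.const_mul_atTop hc) m

lemma integral_Ioi_sq_poissonWeight {b : ℝ} (hb : 0 ≤ b) (m : ℕ) :
    IntegrableOn (fun x => x * poissonWeight (x ^ 2 / 2) m) (Ioi b) ∧
      ∫ x in Ioi b, x * poissonWeight (x ^ 2 / 2) m = poissonCDF (m + 1) (b ^ 2 / 2) :=
  integral_Ioi_deriv_mul_poissonWeight (φ := fun x => x ^ 2 / 2) (φ' := fun x => x)
    (fun x _ => ((hasDerivAt_pow 2 x).div_const 2).congr_deriv (by simp))
    (fun x _ => by positivity) (fun x hx => hb.trans (le_of_lt hx))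
    ((Filter.tendsto_pow_atTop two_ne_zero).atTop_div_const two_pos) m

/-! ### Marcum functions and `κ`-`μ` densities as Poisson mixtures -/

/-- The generalized Marcum function of integer order as a Poisson mixture. -/
lemma hasSum_marcumQ (v : ℕ) {α β : ℝ} (hα : 0 < α) (hβ : 0 ≤ β) :
    HasSum (fun k => poissonWeight (α ^ 2 / 2) k * poissonCDF (v + k + 1) (β ^ 2 / 2))
      (marcumQ ((v + 1 : ℕ) : ℝ) α β) := by
  set y := α ^ 2 / 2 with hy
  have hy0 : 0 < y := by positivity
  have h := integrableOn_and_hasSum_of_nonneg (s := Ioi β) measurableSet_Ioi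
    (F := fun k x => poissonWeight y k * (x * poissonWeight (x ^ 2 / 2) (v + k)))
    (f := fun x => 1 / α ^ v * (x ^ ((v + 1 : ℕ) : ℝ) * Real.exp (-((x ^ 2 + α ^ 2) / 2)) *
      besselI v (α * x)))
    (c := fun k => poissonWeight y k * poissonCDF (v + k + 1) (β ^ 2 / 2))
    (fun k => (integral_Ioi_sq_poissonWeight hβ (v + k)).1.const_mul _)
    (fun k x hx => mul_nonneg (poissonWeight_nonneg hy0.le k)
      (mul_nonneg (hβ.trans (le_of_lt hx)) (poissonWeight_nonneg (by positivity) _)))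
    (fun k => by rw [integral_const_mul, (integral_Ioi_sq_poissonWeight hβ (v + k)).2])
    (summable_poissonWeight_mul hy0.le fun k => abs_poissonCDF_le_one _ (by positivity))
    (fun x hx => by
      have hx0 : 0 < x := lt_of_le_of_lt hβ hx
      have hs := (hasSum_skellam_nat hy0 (show 0 < x ^ 2 / 2 by positivity) v).mul_left x
      have e1 : x ^ 2 / 2 / y = (x / α) ^ 2 := by rw [hy]; field_simp
      have e2 : y * (x ^ 2 / 2) = (α * x / 2) ^ 2 := by rw [hy]; ring
      rw [e1, e2, Real.sqrt_sq (by positivity), Real.sqrt_sq (by positivity)] at hs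
      refine hs.of_forall_eq (fun k => by ring) ?_
      rw [Real.rpow_natCast, show -(y + x ^ 2 / 2) = -((x ^ 2 + α ^ 2) / 2) by rw [hy]; ring,
        show 2 * (α * x / 2) = α * x by ring, pow_succ, div_pow]
      field_simp)
  have e : marcumQ ((v + 1 : ℕ) : ℝ) α β = ∫ x in Ioi β, 1 / α ^ v *
      (x ^ ((v + 1 : ℕ) : ℝ) * Real.exp (-((x ^ 2 + α ^ 2) / 2)) * besselI v (α * x)) := by
    rw [integral_const_mul, marcumQ, show ((v + 1 : ℕ) : ℝ) - 1 = v by push_cast; ring,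
      Real.rpow_natCast]
  rw [e]
  exact h.2

lemma rpow_half_natCast {a : ℝ} (ha : 0 ≤ a) (n : ℕ) : a ^ ((n : ℝ) / 2) = √a ^ n := by
  rw [Real.sqrt_eq_rpow, ← Real.rpow_mul_natCast ha]
  congr 1; ring

/-- The `κ`-`μ` density as a Poisson mixture of Erlang densities. -/
lemma hasSum_kappaMuPDF (v : ℕ) {κ g x : ℝ} (hκ : 0 < κ) (hg : 0 < g) (hx : 0 < x) :
    HasSum (fun k => poissonWeight (κ * (v + 1 : ℕ)) k *
        ((1 + κ) * (v + 1 : ℕ) / g * poissonWeight ((1 + κ) * (v + 1 : ℕ) / g * x) (v + k)))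
      (kappaMuPDF κ (v + 1 : ℕ) g x) := by
  set μ : ℝ := ((v + 1 : ℕ) : ℝ) with hμ
  have hμ0 : 0 < μ := by positivity
  have hκ1 : 0 < 1 + κ := by positivity
  set c := (1 + κ) * μ / g with hc
  have hc0 : 0 < c := by positivity
  have h := (hasSum_skellam_nat (show 0 < κ * μ by positivity) (show 0 < c * x by positivity)
    v).mul_left c
  refine h.of_forall_eq (fun k => by ring) ?_
  · have hv : μ - 1 = v := by rw [hμ]; push_cast; ring
    have hv' : (μ + 1) / 2 = (v : ℝ) / 2 + 1 := by rw [← hv]; ring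
    have e1 : κ * μ * (c * x) = μ ^ 2 * (κ * (1 + κ) * x / g) := by rw [hc]; field_simp
    have e2 : c * x / (κ * μ) = (1 + κ) * x / (κ * g) := by rw [hc]; field_simp
    have e3 : Real.exp (-(κ * μ + c * x)) = Real.exp (-(μ * (1 + κ) * x) / g) / Real.exp (μ * κ) := by
      rw [← Real.exp_sub]; congr 1; rw [hc]; field_simp; ring
    have e4 : √((1 + κ) * x / (κ * g)) = √(1 + κ) * √x / (√κ * √g) := by
      rw [Real.sqrt_div (by positivity), Real.sqrt_mul hκ1.le, Real.sqrt_mul hκ.le]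
    rw [kappaMuPDF, if_pos hx, hv, hv', e1, e2, e3, Real.sqrt_mul (by positivity),
      Real.sqrt_sq hμ0.le, Real.rpow_add_one hκ1.ne', Real.rpow_add_one hg.ne',
      rpow_half_natCast hκ1.le, rpow_half_natCast hg.le, rpow_half_natCast hκ.le,
      rpow_half_natCast hx.le, e4, div_pow, mul_pow, mul_pow, ← mul_assoc 2, hc]
    have := (Real.sqrt_pos.2 hκ).ne'
    have := (Real.sqrt_pos.2 hg).ne'
    have := (Real.exp_pos (μ * κ)).ne'
    field_simp

lemma integrableOn_and_hasSum_integral_kappaMuPDF (v : ℕ) {κ g b : ℝ} (hκ : 0 < κ) (hg : 0 < g)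
    (hb : 0 ≤ b) :
    IntegrableOn (kappaMuPDF κ (v + 1 : ℕ) g) (Ioi b) ∧
      HasSum (fun k => poissonWeight (κ * (v + 1 : ℕ)) k *
          poissonCDF (v + k + 1) ((1 + κ) * (v + 1 : ℕ) / g * b))
        (∫ x in Ioi b, kappaMuPDF κ (v + 1 : ℕ) g x) := by
  have hc : 0 < (1 + κ) * (v + 1 : ℕ) / g := by positivity
  have hl : 0 ≤ κ * (v + 1 : ℕ) := by positivity
  exact integrableOn_and_hasSum_of_nonneg measurableSet_Ioi
    (fun k => (integral_Ioi_poissonWeight hc hb (v + k)).1.const_mul _)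
    (fun k x hx => mul_nonneg (poissonWeight_nonneg hl k) (mul_nonneg hc.le
      (poissonWeight_nonneg (mul_nonneg hc.le (hb.trans (le_of_lt hx))) _)))
    (fun k => by rw [integral_const_mul, (integral_Ioi_poissonWeight hc hb (v + k)).2])
    (summable_poissonWeight_mul hl fun k => abs_poissonCDF_le_one _ (by positivity))
    fun x hx => hasSum_kappaMuPDF v hκ hg (lt_of_le_of_lt hb hx)

lemma hasSum_marcumQ_snr (v : ℕ) {κ g x : ℝ} (hκ : 0 < κ) (hg : 0 < g) (hx : 0 ≤ x) :
    HasSum (fun k => poissonWeight (κ * (v + 1 : ℕ)) k *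
        poissonCDF (v + k + 1) ((1 + κ) * (v + 1 : ℕ) / g * x))
      (marcumQ (v + 1 : ℕ) √(2 * κ * (v + 1 : ℕ)) √(2 * (1 + κ) * (v + 1 : ℕ) * x / g)) := by
  have h := hasSum_marcumQ v (α := √(2 * κ * (v + 1 : ℕ)))
    (β := √(2 * (1 + κ) * (v + 1 : ℕ) * x / g)) (by positivity) (by positivity)
  rw [Real.sq_sqrt (by positivity), Real.sq_sqrt (by positivity)] at h
  convert h using 4 <;> ring

/-- The tail of the `κ`-`μ` law is a Marcum function. -/
lemma integral_kappaMuPDF_eq_marcumQ (v : ℕ) {κ g x : ℝ} (hκ : 0 < κ) (hg : 0 < g) (hx : 0 ≤ x) :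
    ∫ y in Ioi x, kappaMuPDF κ (v + 1 : ℕ) g y =
      marcumQ (v + 1 : ℕ) √(2 * κ * (v + 1 : ℕ)) √(2 * (1 + κ) * (v + 1 : ℕ) * x / g) :=
  (integrableOn_and_hasSum_integral_kappaMuPDF v hκ hg hx).2.unique (hasSum_marcumQ_snr v hκ hg hx)

/-! ### The integral as a mixture of binomial tails -/

/-- Expanding the CDF turns each term into an Erlang density of rate `c + d` times a negative
binomial weight, and the densities integrate to `1`. -/
lemma integral_poissonWeight_mul_poissonCDF {c d : ℝ} (hc : 0 < c) (hd : 0 < d) (n m : ℕ) :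
    IntegrableOn (fun x => d * poissonWeight (d * x) n * poissonCDF m (c * x)) (Ioi 0) ∧
      ∫ x in Ioi 0, d * poissonWeight (d * x) n * poissonCDF m (c * x) =
        1 - binTail (c / (c + d)) (m + n) m := by
  set q := c / (c + d) with hq
  have hp : 1 - q = d / (c + d) := by rw [hq]; field_simp; ring
  have h0 : 0 < q := by positivity
  have h1 : q < 1 := by have : 0 < d / (c + d) := by positivity
                        linarith
  have hterm : (fun x => d * poissonWeight (d * x) n * poissonCDF m (c * x)) = fun x =>
      ∑ i ∈ Finset.range m, ((n + i).choose i : ℝ) * ((1 - q) ^ (n + 1) * q ^ i) *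
        ((c + d) * poissonWeight ((c + d) * x) (n + i)) := by
    funext x
    rw [poissonCDF, Finset.mul_sum]
    refine Finset.sum_congr rfl fun i _ => ?_
    rw [Nat.cast_choose ℝ (Nat.le_add_left i n), Nat.add_sub_cancel, hp, hq]
    unfold poissonWeight
    rw [show Real.exp (-((c + d) * x)) = Real.exp (-(c * x)) * Real.exp (-(d * x)) by
      rw [← Real.exp_add]; congr 1; ring, mul_pow, mul_pow, mul_pow, div_pow, div_pow]
    have := n.factorial_ne_zero
    have := i.factorial_ne_zero
    have := (n + i).factorial_ne_zero
    have : c + d ≠ 0 := by positivity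
    field_simp
    ring
  have hi : ∀ k, _ := fun k => integral_Ioi_poissonWeight (add_pos hc hd) le_rfl k
  rw [hterm]
  constructor
  · exact integrable_finsetSum _ fun i _ => (hi (n + i)).1.const_mul _
  · rw [integral_finsetSum _ fun i _ => (hi (n + i)).1.const_mul _,
      ← sum_choose_eq_one_sub_binTail h0 h1]
    refine Finset.sum_congr rfl fun i _ => ?_
    rw [integral_const_mul, (hi (n + i)).2, mul_zero, poissonCDF_succ_zero, mul_one]

/-- The integral representation as a double Poisson mixture of binomial tails. -/
lemma integrableOn_and_integral_spscIntegrand (v μ : ℕ) {κM gM κE gE c d : ℝ} (hκM : 0 < κM)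
    (hgM : 0 < gM) (hκE : 0 < κE) (hgE : 0 < gE) (hc : c = (1 + κM) * (v + 1 : ℕ) / gM)
    (hd : d = (1 + κE) * (μ + 1 : ℕ) / gE) :
    IntegrableOn (spscIntegrand κM (v + 1 : ℕ) gM κE (μ + 1 : ℕ) gE) (Ioi 0) ∧
      ∫ x in Ioi 0, spscIntegrand κM (v + 1 : ℕ) gM κE (μ + 1 : ℕ) gE x =
        1 - ∑' J, poissonWeight (κM * (v + 1 : ℕ)) J * ∑' K, poissonWeight (κE * (μ + 1 : ℕ)) K *
          binTail (c / (c + d)) (v + μ + 1 + J + K) ((v : ℤ) + 1 + J) := by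
  have hc0 : 0 < c := by rw [hc]; positivity
  have hd0 : 0 < d := by rw [hd]; positivity
  have hl : 0 ≤ κM * (v + 1 : ℕ) := by positivity
  have hτ : 0 ≤ κE * (μ + 1 : ℕ) := by positivity
  have q0 : 0 ≤ c / (c + d) := by positivity
  have q1 : c / (c + d) ≤ 1 := by rw [div_le_one (by positivity)]; linarith
  have hb := abs_binTail_le_one q0 q1
  set T : ℕ → ℝ := fun J => ∑' K, poissonWeight (κE * (μ + 1 : ℕ)) K *
    binTail (c / (c + d)) (v + μ + 1 + J + K) ((v : ℤ) + 1 + J) with hT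
  have hTs : ∀ J, Summable fun K => poissonWeight (κE * (μ + 1 : ℕ)) K *
      binTail (c / (c + d)) (v + μ + 1 + J + K) ((v : ℤ) + 1 + J) := fun J =>
    summable_poissonWeight_mul hτ fun K => hb _ _
  have hT1 : ∀ J, |T J| ≤ 1 := fun J => abs_tsum_poissonWeight_mul_le hτ fun K => hb _ _
  have inner : ∀ J, IntegrableOn (fun x => kappaMuPDF κE (μ + 1 : ℕ) gE x *
        poissonCDF (v + J + 1) (c * x)) (Ioi 0) ∧
      HasSum (fun K => poissonWeight (κE * (μ + 1 : ℕ)) K *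
          (1 - binTail (c / (c + d)) (v + μ + 1 + J + K) ((v : ℤ) + 1 + J)))
        (∫ x in Ioi 0, kappaMuPDF κE (μ + 1 : ℕ) gE x * poissonCDF (v + J + 1) (c * x)) := by
    intro J
    have hi := fun K => integral_poissonWeight_mul_poissonCDF hc0 hd0 (μ + K) (v + J + 1)
    refine integrableOn_and_hasSum_of_nonneg measurableSet_Ioi
      (F := fun K x => poissonWeight (κE * (μ + 1 : ℕ)) K *
        (d * poissonWeight (d * x) (μ + K) * poissonCDF (v + J + 1) (c * x)))
      (fun K => (hi K).1.const_mul _) (fun K x hx => ?_) (fun K => ?_) ?_ fun x hx => ?_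
    · have hx0 : 0 < x := hx
      have h1 := poissonWeight_nonneg hτ K
      have h2 := poissonWeight_nonneg (mul_pos hd0 hx0).le (μ + K)
      have h3 := poissonCDF_nonneg (v + J + 1) (mul_pos hc0 hx0).le
      positivity
    · rw [integral_const_mul, (hi K).2]
      rw [show v + J + 1 + (μ + K) = v + μ + 1 + J + K by ring,
        show ((v + J + 1 : ℕ) : ℤ) = (v : ℤ) + 1 + J by push_cast; ring]
    · simp only [mul_sub, mul_one]
      exact (hasSum_poissonWeight _).summable.sub (hTs J)
    · have h := (hasSum_kappaMuPDF μ hκE hgE hx).mul_right (poissonCDF (v + J + 1) (c * x))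
      rw [← hd] at h
      simpa only [mul_assoc] using h
  have inner' : ∀ J, ∫ x in Ioi 0, kappaMuPDF κE (μ + 1 : ℕ) gE x *
      poissonCDF (v + J + 1) (c * x) = 1 - T J := by
    intro J
    have h := (hasSum_poissonWeight (κE * (μ + 1 : ℕ))).sub (hTs J).hasSum
    simp only [← mul_one_sub] at h
    exact (inner J).2.unique h
  have hw := summable_poissonWeight_mul hl hT1
  have hpdf : ∀ x ∈ Ioi (0 : ℝ), 0 ≤ kappaMuPDF κE (μ + 1 : ℕ) gE x := fun x hx =>
    (hasSum_kappaMuPDF μ hκE hgE hx).nonneg fun K => by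
      have hx0 : 0 < x := hx
      have h1 := poissonWeight_nonneg hτ K
      rw [← hd]
      have h2 := poissonWeight_nonneg (mul_pos hd0 hx0).le (μ + K)
      positivity
  have outer := integrableOn_and_hasSum_of_nonneg measurableSet_Ioi
    (F := fun J x => poissonWeight (κM * (v + 1 : ℕ)) J * (kappaMuPDF κE (μ + 1 : ℕ) gE x *
      poissonCDF (v + J + 1) (c * x)))
    (f := spscIntegrand κM (v + 1 : ℕ) gM κE (μ + 1 : ℕ) gE)
    (c := fun J => poissonWeight (κM * (v + 1 : ℕ)) J * (1 - T J))
    (fun J => (inner J).1.const_mul _)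
    (fun J x hx => mul_nonneg (poissonWeight_nonneg hl J) (mul_nonneg (hpdf x hx)
      (poissonCDF_nonneg _ (mul_pos hc0 hx).le)))
    (fun J => by rw [integral_const_mul, inner' J])
    (by
      simp only [mul_one_sub]
      exact (hasSum_poissonWeight _).summable.sub hw)
    (fun x hx => by
      have h := (hasSum_marcumQ_snr v hκM hgM (le_of_lt hx)).mul_left
        (kappaMuPDF κE (μ + 1 : ℕ) gE x)
      rw [← hc] at h
      exact h.of_forall_eq (fun J => by ring) rfl)
  refine ⟨outer.1, ?_⟩
  have h := (hasSum_poissonWeight (κM * (v + 1 : ℕ))).sub hw.hasSum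
  simp only [← mul_one_sub] at h
  exact outer.2.unique h

/-! ### Evaluating the mixture -/

lemma hasSum_poissonWeight_mul_ite (c : ℝ) (l : ℤ) :
    HasSum (fun j : ℕ => poissonWeight c j * if (j : ℤ) = l then 1 else 0)
      (poissonWeightInt c l) := by
  rcases lt_or_ge l 0 with hl | hl
  · have h : ∀ j : ℕ, (j : ℤ) ≠ l := fun j => by omega
    rw [poissonWeightInt, if_neg hl.not_ge]
    exact hasSum_zero.of_forall_eq (fun j => by rw [if_neg (h j), mul_zero]) rfl
  · obtain ⟨n, rfl⟩ := Int.eq_ofNat_of_zero_le hl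
    rw [poissonWeightInt_natCast]
    have h := hasSum_single (f := fun j : ℕ => poissonWeight c j * if (j : ℤ) = n then 1 else 0) n
      fun j hj => by simp [hj]
    exact h.of_forall_eq (fun _ => rfl) (by simp)

lemma abs_ite_le_one (p : Prop) [Decidable p] : |if p then (1 : ℝ) else 0| ≤ 1 := by
  split_ifs <;> simp

/-- `Q_1` is the probability that one Poisson variable is at most another one. -/
lemma hasSum_marcumQ_one {x y : ℝ} (hx : 0 < x) (hy : 0 < y) :
    HasSum (fun i : ℕ => poissonWeight x i * ∑' j : ℕ, poissonWeight y j * if i ≤ j then 1 else 0)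
      (marcumQ 1 √(2 * y) √(2 * x)) := by
  have hq := hasSum_marcumQ 0 (α := √(2 * y)) (β := √(2 * x)) (by positivity) (by positivity)
  rw [Real.sq_sqrt (by positivity), Real.sq_sqrt (by positivity),
    mul_div_cancel_left₀ _ two_ne_zero, mul_div_cancel_left₀ _ two_ne_zero, zero_add,
    Nat.cast_one] at hq
  have hg : ∀ i : ℕ, |∑' j : ℕ, poissonWeight y j * if i ≤ j then 1 else 0| ≤ 1 := fun i =>
    abs_tsum_poissonWeight_mul_le hy.le fun j => abs_ite_le_one _
  have hs := (summable_poissonWeight_mul hx.le hg).hasSum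
  refine hs.of_forall_eq (fun _ => rfl) ?_
  rw [← hq.tsum_eq]
  have hsum : Summable (Function.uncurry fun i j : ℕ =>
      poissonWeight x i * (poissonWeight y j * if i ≤ j then 1 else 0)) := by
    refine Summable.of_norm_bounded ((hasSum_poissonWeight x).summable.mul_of_nonneg
      (hasSum_poissonWeight y).summable (poissonWeight_nonneg hx.le)
      (poissonWeight_nonneg hy.le)) fun p => ?_
    have h1 := poissonWeight_nonneg hx.le p.1
    have h2 := poissonWeight_nonneg hy.le p.2
    rw [Function.uncurry, Real.norm_eq_abs]
    split_ifs
    · rw [mul_one, abs_of_nonneg (by positivity)]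
    · simpa using mul_nonneg h1 h2
  simp only [← tsum_mul_left]
  -- Summing over `i` first leaves, for fixed `j`, the probability of a value at most `j`, as in the
  -- Marcum mixture.
  rw [← hsum.tsum_comm]
  refine tsum_congr fun j => ?_
  rw [poissonCDF, Finset.mul_sum, tsum_eq_sum (s := Finset.range (0 + j + 1))]
  · refine Finset.sum_congr rfl fun i hi => ?_
    rw [if_pos (by have := Finset.mem_range.1 hi; omega)]
    ring
  · intro i hi
    rw [if_neg (by rw [Finset.mem_range] at hi; omega)]
    ring

lemma binTail_one (q : ℝ) (i j : ℕ) :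
    binTail q 1 (1 - ((j : ℤ) - i)) =
      (if i ≤ j then 1 else 0) - (1 - q) * if (j : ℤ) = i then 1 else 0 := by
  rw [binTail, binTail, binTail]
  rcases lt_trichotomy i j with h | rfl | h
  · rw [if_pos (by omega), if_pos (by omega), if_pos h.le, if_neg (by omega)]; ring
  · simp
  · rw [if_neg (by omega), if_neg (by omega), if_neg (by omega), if_neg (by omega)]; ring

lemma tsum_tsum_binTail_eq {x y q : ℝ} (hx : 0 < x) (hy : 0 < y) (h0 : 0 < q) (h1 : q < 1)
    (μ v : ℕ) :
    ∑' i : ℕ, poissonWeight x i *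
        ∑' j : ℕ, poissonWeight y j * binTail q (v + μ + 1) ((v : ℤ) + 1 + i - j) =
      marcumQ 1 √(2 * y) √(2 * x) -
        (1 - q) * (Real.exp (-(x + y)) * besselI 0 (2 * √(x * y))) +
      ∑ l ∈ Finset.Icc (-(μ : ℤ)) (v : ℤ), skellamCoeff q μ v l *
        (Real.exp (-(x + y)) * √(y / x) ^ l * besselI l (2 * √(x * y))) := by
  have hsk := hasSum_skellam hx hy
  have h00 := hsk 0
  simp only [zpow_zero, mul_one, Int.cast_zero] at h00
  refine HasSum.tsum_eq ?_
  refine (((hasSum_marcumQ_one hx hy).sub (h00.mul_left (1 - q))).add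
    (hasSum_sum fun l _ => (hsk l).mul_left (skellamCoeff q μ v l))).of_forall_eq (fun i => ?_) rfl
  have hS := (summable_poissonWeight_mul hy.le
    (g := fun j : ℕ => if i ≤ j then 1 else 0) fun j => abs_ite_le_one _).hasSum
  have hinner := (hS.sub ((hasSum_poissonWeight_mul_ite y i).mul_left (1 - q))).add
    (hasSum_sum (s := Finset.Icc (-(μ : ℤ)) (v : ℤ)) fun l _ =>
      (hasSum_poissonWeight_mul_ite y (i + l)).mul_left (skellamCoeff q μ v l))
  have hval : ∑' j : ℕ, poissonWeight y j * binTail q (v + μ + 1) ((v : ℤ) + 1 + i - j) = _ :=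
    (hinner.of_forall_eq (fun j => by
      -- Sorting by the value `l` of `j - i` makes the correction a finite sum of indicators, each
      -- of which yields a Skellam weight.
      have hc : skellamCoeff q μ v ((j : ℤ) - i) = ∑ l ∈ Finset.Icc (-(μ : ℤ)) (v : ℤ),
          skellamCoeff q μ v l * if (j : ℤ) = i + l then 1 else 0 := by
        by_cases hm : (j : ℤ) - i ∈ Finset.Icc (-(μ : ℤ)) (v : ℤ)
        · rw [Finset.sum_eq_single_of_mem _ hm fun l _ hl => by
            rw [if_neg (by omega), mul_zero], if_pos (by omega), mul_one]
        · rw [skellamCoeff_eq_zero q hm, Finset.sum_eq_zero fun l hl => ?_]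
          rw [if_neg, mul_zero]
          rintro h
          exact hm (by rwa [show (j : ℤ) - i = l by omega])
      rw [show (v : ℤ) + 1 + i - j = (v : ℤ) + 1 - ((j : ℤ) - i) by ring,
        binTail_eq_add_skellamCoeff h0 h1, binTail_one, hc, mul_add, Finset.mul_sum]
      congr 1
      · ring
      · exact Finset.sum_congr rfl fun l _ => by ring) rfl).tsum_eq
  rw [hval, mul_add, Finset.mul_sum, add_zero]
  congr 1
  · ring
  · exact Finset.sum_congr rfl fun l _ => by ring

/-! ### Matching the closed form -/

lemma spscSum_eq {A B r R x y : ℝ} (hA : 0 < A) (hB : 0 < B) (hr : 0 < r) (hR : R = r + r⁻¹)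
    (hx : x = B ^ 2 / 2 * (1 - r / R)) (hy : y = A ^ 2 / 2 * (r / R)) (μ v : ℕ) :
    spscSum μ v A B r R =
      ∑ l ∈ Finset.Icc (-(μ : ℤ)) (v : ℤ), skellamCoeff (r / R) μ v l *
        (Real.exp (-(x + y)) * √(y / x) ^ l * besselI l (2 * √(x * y))) := by
  have hR0 : 0 < R := by rw [hR]; positivity
  have hp : 1 - r / R = r⁻¹ / R := by
    rw [eq_div_iff hR0.ne', sub_mul, div_mul_cancel₀ _ hR0.ne', hR]; ring
  rw [hp] at hx
  have e1 : -(x + y) = -((A ^ 2 * r + B ^ 2 * r⁻¹) / (2 * R)) := by rw [hx, hy]; field_simp; ring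
  have e2 : √(y / x) = A / B * r := by
    rw [show y / x = (A / B * r) ^ 2 by rw [hx, hy]; field_simp, Real.sqrt_sq (by positivity)]
  have e3 : 2 * √(x * y) = A * B / R := by
    rw [show x * y = (A * B / R / 2) ^ 2 by rw [hx, hy]; field_simp,
      Real.sqrt_sq (by positivity)]
    ring
  rw [spscSum, Finset.mul_sum]
  refine Finset.sum_congr rfl fun l _ => ?_
  -- With `q = r/R` and `1 - q = r⁻¹/R`, the powers of `R` depending on `l` cancel and those of `r`
  -- combine to `r^(-l)`; the same happens in `key2`.
  have key1 : ∀ k : ℕ, (A / B * r) ^ l * ((r / R) ^ ((v : ℤ) + 1 - l) * (r⁻¹ / R) ^ ((k : ℤ) + l)) =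
      (A / (B * r)) ^ l * (r ^ ((v : ℤ) - k + 1) * R ^ (-(v : ℤ) - k - 1)) := by
    intro k
    rw [show (v : ℤ) - k + 1 = v + 1 - k by ring, show -(v : ℤ) - k - 1 = -(v + 1 + k) by ring]
    simp only [div_zpow, mul_zpow, inv_zpow, zpow_sub₀ hr.ne', zpow_sub₀ hR0.ne', zpow_add₀ hr.ne',
      zpow_add₀ hR0.ne', zpow_neg]
    field_simp
  have key2 : ∀ j : ℕ, (A / B * r) ^ l * ((r / R) ^ ((j : ℤ) - l) * (r⁻¹ / R) ^ (l + 1)) =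
      (A / (B * r)) ^ l * (r ^ ((j : ℤ) - 1) * R ^ (-(j : ℤ) - 1)) := by
    intro j
    rw [show -(j : ℤ) - 1 = -(j + 1) by ring]
    simp only [div_zpow, mul_zpow, inv_zpow, zpow_sub₀ hr.ne', zpow_sub₀ hR0.ne', zpow_add₀ hr.ne',
      zpow_add₀ hR0.ne', zpow_neg]
    field_simp
  have hcoeff : skellamCoeff (r / R) μ v l * (A / B * r) ^ l = (A / (B * r)) ^ l *
      ((∑ k ∈ Finset.Icc 1 μ, (intChoose (v + k) (k + l) : ℝ) *
          r ^ ((v : ℤ) - k + 1) * R ^ (-(v : ℤ) - k - 1)) -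
        ∑ j ∈ Finset.Icc 1 v, (intChoose j l : ℝ) *
          r ^ ((j : ℤ) - 1) * R ^ (-(j : ℤ) - 1)) := by
    rw [skellamCoeff, hp, sub_mul, mul_sub, Finset.sum_mul, Finset.sum_mul, Finset.mul_sum,
      Finset.mul_sum]
    congr 1
    · exact Finset.sum_congr rfl fun k _ => by
        linear_combination (intChoose (v + k) (k + l) : ℝ) * key1 k
    · exact Finset.sum_congr rfl fun j _ => by
        linear_combination (intChoose j l : ℝ) * key2 j
  rw [e1, e2, e3]
  linear_combination -Real.exp (-((A ^ 2 * r + B ^ 2 * r⁻¹) / (2 * R))) *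
    besselI l (A * B / R) * hcoeff

lemma spscPPrime_eq {κM μM a κE μE b c d x y : ℝ} (hκM : 0 < κM) (hμM : 0 < μM) (ha : 0 < a)
    (hκE : 0 < κE) (hμE : 0 < μE) (hb : 0 < b) (hc : c = (1 + κM) * μM * a)
    (hd : d = (1 + κE) * μE * b) (hx : x = κM * μM * (1 - c / (c + d)))
    (hy : y = κE * μE * (c / (c + d))) :
    spscPPrime κM μM a κE μE b = marcumQ 1 √(2 * y) √(2 * x) -
      (1 - c / (c + d)) * (Real.exp (-(x + y)) * besselI 0 (2 * √(x * y))) := by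
  have hc0 : 0 < c := by rw [hc]; positivity
  have hd0 : 0 < d := by rw [hd]; positivity
  have hD : b * (1 + κE) * μE + a * (1 + κM) * μM = c + d := by rw [hc, hd]; ring
  have hp : 1 - c / (c + d) = d / (c + d) := by field_simp; ring
  rw [hp] at hx
  have e1 : 2 * κE * a * μE * μM * (1 + κM) / (c + d) = 2 * y := by rw [hy, hc]; ring
  have e2 : 2 * κM * b * μE * μM * (1 + κE) / (c + d) = 2 * x := by rw [hx, hd]; ring
  have e3 : (a * κE * μM * μE * (1 + κM) + b * κM * μM * μE * (1 + κE)) / (c + d) = x + y := by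
    rw [show a * κE * μM * μE * (1 + κM) + b * κM * μM * μE * (1 + κE) =
      κM * μM * d + κE * μE * c by rw [hc, hd]; ring, hx, hy]
    ring
  have e4 : 2 * μE * μM * √(a * b * κM * κE * (1 + κE) * (1 + κM)) / (c + d) =
      2 * √(x * y) := by
    have : x * y = (μE * μM / (c + d)) ^ 2 * (a * b * κM * κE * (1 + κE) * (1 + κM)) := by
      have hcd : c * d = (1 + κM) * μM * a * ((1 + κE) * μE * b) := by rw [← hc, ← hd]
      have hxy : x * y = κM * μM * κE * μE * (c * d) / (c + d) ^ 2 := by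
        rw [hx, hy]; field_simp
      rw [hxy, hcd, div_pow, div_mul_eq_mul_div]
      ring
    rw [this, Real.sqrt_mul (sq_nonneg (μE * μM / (c + d))), Real.sqrt_sq (by positivity)]
    ring
  rw [spscPPrime, hD, e1, e2, e3, e4, hp, hd]
  ring

/-! ### From densities to probabilities -/

lemma kappaMuPDF_of_nonpos {κ μ g x : ℝ} (hx : x ≤ 0) : kappaMuPDF κ μ g x = 0 := by
  rw [kappaMuPDF, if_neg hx.not_gt]

lemma kappaMuPDF_nonneg (v : ℕ) {κ g : ℝ} (hκ : 0 < κ) (hg : 0 < g) (x : ℝ) :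
    0 ≤ kappaMuPDF κ (v + 1 : ℕ) g x := by
  rcases le_or_gt x 0 with hx | hx
  · rw [kappaMuPDF_of_nonpos hx]
  · refine (hasSum_kappaMuPDF v hκ hg hx).nonneg fun k => ?_
    have h1 := poissonWeight_nonneg (show 0 ≤ κ * (v + 1 : ℕ) by positivity) k
    have h2 := poissonWeight_nonneg (show 0 ≤ (1 + κ) * (v + 1 : ℕ) / g * x by positivity) (v + k)
    positivity

lemma integrable_kappaMuPDF (v : ℕ) {κ g : ℝ} (hκ : 0 < κ) (hg : 0 < g) :
    Integrable (kappaMuPDF κ (v + 1 : ℕ) g) := by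
  have h := (integrableOn_and_hasSum_integral_kappaMuPDF v hκ hg le_rfl).1
  rwa [← integrable_indicator_iff measurableSet_Ioi, indicator_eq_self.2 fun x hx => ?_] at h
  by_contra hx'
  exact hx (kappaMuPDF_of_nonpos (not_lt.1 hx'))

lemma kappaMuLaw_Ioi (v : ℕ) {κ g x : ℝ} (hκ : 0 < κ) (hg : 0 < g) (hx : 0 ≤ x) :
    kappaMuLaw κ (v + 1 : ℕ) g (Ioi x) = ENNReal.ofReal
      (marcumQ (v + 1 : ℕ) √(2 * κ * (v + 1 : ℕ)) √(2 * (1 + κ) * (v + 1 : ℕ) * x / g)) := by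
  rw [← integral_kappaMuPDF_eq_marcumQ v hκ hg hx, kappaMuLaw, withDensity_apply _ measurableSet_Ioi,
    ofReal_integral_eq_lintegral_ofReal (integrable_kappaMuPDF v hκ hg).integrableOn
      (.of_forall fun y => kappaMuPDF_nonneg v hκ hg y)]

lemma kappaMuLaw_prod_lt (v μ : ℕ) {κM gM κE gE : ℝ} (hκM : 0 < κM) (hgM : 0 < gM)
    (hκE : 0 < κE) (hgE : 0 < gE) [IsProbabilityMeasure (kappaMuLaw κM (v + 1 : ℕ) gM)] :
    ((kappaMuLaw κE (μ + 1 : ℕ) gE).prod (kappaMuLaw κM (v + 1 : ℕ) gM)) {p | p.1 < p.2} =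
      ENNReal.ofReal
        (∫ x in Ioi 0, spscIntegrand κM (v + 1 : ℕ) gM κE (μ + 1 : ℕ) gE x) := by
  have hint := (integrableOn_and_integral_spscIntegrand v μ hκM hgM hκE hgE rfl rfl).1
  have hset : MeasurableSet {p : ℝ × ℝ | p.1 < p.2} := measurableSet_lt measurable_fst measurable_snd
  have hnn : ∀ x ∈ Ioi (0 : ℝ), 0 ≤ spscIntegrand κM (v + 1 : ℕ) gM κE (μ + 1 : ℕ) gE x :=
    fun x hx => mul_nonneg (kappaMuPDF_nonneg μ hκE hgE x) <|
      (hasSum_marcumQ_snr v hκM hgM (le_of_lt hx)).nonneg fun k =>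
        mul_nonneg (poissonWeight_nonneg (by positivity) k)
          (poissonCDF_nonneg _ (mul_nonneg (by positivity) (le_of_lt hx)))
  -- Monotonicity supplies the measurability in `y` of the section measures.
  have hanti : Antitone fun y => kappaMuLaw κM (v + 1 : ℕ) gM (Ioi y) :=
    fun y z h => measure_mono (Ioi_subset_Ioi h)
  rw [Measure.prod_apply hset, ofReal_integral_eq_lintegral_ofReal hint
    ((ae_restrict_iff' measurableSet_Ioi).2 <| .of_forall hnn), ← lintegral_indicator measurableSet_Ioi]
  change ∫⁻ y, kappaMuLaw κM (v + 1 : ℕ) gM (Ioi y) ∂(kappaMuLaw κE (μ + 1 : ℕ) gE) = _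
  rw [kappaMuLaw, lintegral_withDensity_eq_lintegral_mul₀
    (integrable_kappaMuPDF μ hκE hgE).1.aemeasurable.ennreal_ofReal hanti.measurable.aemeasurable]
  refine lintegral_congr fun y => ?_
  rw [Pi.mul_apply]
  rcases le_or_gt y 0 with hy | hy
  · rw [kappaMuPDF_of_nonpos hy, indicator_of_notMem (by simpa using hy)]
    simp
  · rw [indicator_of_mem (by exact hy), kappaMuLaw_Ioi v hκM hgM hy.le, spscIntegrand,
      ENNReal.ofReal_mul (kappaMuPDF_nonneg μ hκE hgE y)]

lemma ae_kappaMuLaw_pos (κ μ g : ℝ) (hm : AEMeasurable (kappaMuPDF κ μ g)) :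
    ∀ᵐ x ∂(kappaMuLaw κ μ g), 0 < x := by
  rw [kappaMuLaw, ae_withDensity_iff' hm.ennreal_ofReal]
  refine .of_forall fun x hx => ?_
  by_contra h
  exact hx (by rw [kappaMuPDF_of_nonpos (not_lt.1 h), ENNReal.ofReal_zero])

/-- Positivity of `y` keeps both arguments of `Real.logb` in the range where it is strictly
increasing. -/
lemma secrecyCapacity_pos_iff {x y : ℝ} (hy : 0 < y) : 0 < secrecyCapacity x y ↔ y < x := by
  unfold secrecyCapacity
  split_ifs with h
  · simp only [h, iff_true, sub_pos]
    exact Real.logb_lt_logb one_lt_two (by linarith) (by linarith)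
  · simp [h]

lemma integral_spscIntegrand_eq (v μ : ℕ) {κM gM κE gE a b A B r R : ℝ} (hκM : 0 < κM)
    (hgM : 0 < gM) (hκE : 0 < κE) (hgE : 0 < gE) (ha : a = 1 / gM) (hb : b = 1 / gE)
    (hA : A = √(2 * κE * (μ + 1 : ℕ))) (hB : B = √(2 * κM * (v + 1 : ℕ)))
    (hr : r = √((1 + κM) * (v + 1 : ℕ) * a / ((1 + κE) * (μ + 1 : ℕ) * b))) (hR : R = r + r⁻¹) :
    ∫ x in Ioi 0, spscIntegrand κM (v + 1 : ℕ) gM κE (μ + 1 : ℕ) gE x =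
      1 - spscPPrime κM (v + 1 : ℕ) a κE (μ + 1 : ℕ) b - spscSum μ v A B r R := by
  have ha0 : 0 < a := by rw [ha]; positivity
  have hb0 : 0 < b := by rw [hb]; positivity
  set c := (1 + κM) * (v + 1 : ℕ) * a with hc
  set d := (1 + κE) * (μ + 1 : ℕ) * b with hd
  have hc0 : 0 < c := by positivity
  have hd0 : 0 < d := by positivity
  have hr0 : 0 < r := by rw [hr]; positivity
  have hr2 : r ^ 2 = c / d := by rw [hr, Real.sq_sqrt (by positivity)]
  have hq : r / R = c / (c + d) := by
    have : r / R = r ^ 2 / (r ^ 2 + 1) := by rw [hR]; field_simp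
    rw [this, hr2]; field_simp
  have q0 : 0 < c / (c + d) := by positivity
  have q1 : c / (c + d) < 1 := by rw [div_lt_one (by positivity)]; linarith
  have hp0 : 0 < 1 - c / (c + d) := by linarith
  rw [(integrableOn_and_integral_spscIntegrand v μ hκM hgM hκE hgE
      (show c = (1 + κM) * (v + 1 : ℕ) / gM by rw [hc, ha]; ring)
      (show d = (1 + κE) * (μ + 1 : ℕ) / gE by rw [hd, hb]; ring)).2,
    tsum_tsum_binTail q0.le q1.le (by positivity) (by positivity),
    tsum_tsum_binTail_eq (by positivity) (by positivity) q0 q1,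
    spscPPrime_eq hκM (by positivity) ha0 hκE (by positivity) hb0 hc hd rfl rfl,
    spscSum_eq (by rw [hA]; positivity) (by rw [hB]; positivity) hr0 hR
      (x := κM * (v + 1 : ℕ) * (1 - c / (c + d))) (y := κE * (μ + 1 : ℕ) * (c / (c + d)))
      (by rw [hq, hB, Real.sq_sqrt (by positivity)]; ring)
      (by rw [hq, hA, Real.sq_sqrt (by positivity)]; ring), hq]
  ring

theorem proposition3 (κM κE gM gE : ℝ) (μM μE : ℕ)
    (hκM : 0 < κM) (hκE : 0 < κE) (hgM : 0 < gM) (hgE : 0 < gE) (hμM : 1 ≤ μM) (hμE : 1 ≤ μE)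
    (a b A B r R F : ℝ) (ha : a = 1 / gM) (hb : b = 1 / gE)
    (hA : A = √(2 * κE * μE)) (hB : B = √(2 * κM * μM))
    (hr : r = √((1 + κM) * μM * a / ((1 + κE) * μE * b))) (hR : R = r + r⁻¹)
    (hF : F = 1 - spscPPrime κM μM a κE μE b - spscSum (μE - 1) (μM - 1) A B r R) :
    IntegrableOn (spscIntegrand κM μM gM κE μE gE) (Ioi 0) volume ∧
    ∫ x in Ioi 0, spscIntegrand κM μM gM κE μE gE x = F ∧
    ∀ (Ω : Type*) [MeasurableSpace Ω] (P : Measure Ω) [IsProbabilityMeasure P] (γM γE : Ω → ℝ),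
      HasLaw γM (kappaMuLaw κM μM gM) P → HasLaw γE (kappaMuLaw κE μE gE) P → γM ⟂ᵢ[P] γE →
      P.real {ω | 0 < secrecyCapacity (γM ω) (γE ω)} = F ∧
      P.real {ω | γE ω < γM ω} = F := by
  obtain ⟨v, rfl⟩ := Nat.exists_eq_add_of_le' hμM
  obtain ⟨μ, rfl⟩ := Nat.exists_eq_add_of_le' hμE
  rw [Nat.add_sub_cancel, Nat.add_sub_cancel] at hF
  have hI := integral_spscIntegrand_eq v μ hκM hgM hκE hgE ha hb hA hB hr hR
  rw [← hF] at hI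
  refine ⟨(integrableOn_and_integral_spscIntegrand v μ hκM hgM hκE hgE rfl rfl).1, hI, ?_⟩
  intro Ω _ P _ γM γE hM hE hind
  -- Normalization of the density is inherited from `P` through the law of `γM`.
  have : IsProbabilityMeasure (kappaMuLaw κM (v + 1 : ℕ) gM) := hM.isProbabilityMeasure_iff.1 ‹_›
  have hlt : P.real {ω | γE ω < γM ω} = F := by
    have hmap := (indepFun_iff_map_prod_eq_prod_map_map hE.aemeasurable hM.aemeasurable).1 hind.symm
    rw [hE.map_eq, hM.map_eq] at hmap
    have hset : MeasurableSet {p : ℝ × ℝ | p.1 < p.2} :=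
      measurableSet_lt measurable_fst measurable_snd
    have h := kappaMuLaw_prod_lt v μ hκM hgM hκE hgE
    rw [← hmap, Measure.map_apply_of_aemeasurable (hE.aemeasurable.prodMk hM.aemeasurable) hset,
      hI] at h
    -- Needed because `ENNReal.ofReal` would truncate a negative value.
    have h0 : 0 ≤ F := by
      rw [← hI]
      refine setIntegral_nonneg measurableSet_Ioi fun x hx =>
        mul_nonneg (kappaMuPDF_nonneg μ hκE hgE x) ?_
      rw [← integral_kappaMuPDF_eq_marcumQ v hκM hgM (le_of_lt hx)]
      exact integral_nonneg fun y => kappaMuPDF_nonneg v hκM hgM y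
    rw [measureReal_def, ← ENNReal.toReal_ofReal h0, ← h]
    rfl
  refine ⟨?_, hlt⟩
  rw [← hlt]
  -- The two events agree only where `γE` is positive, which is almost everywhere.
  refine measureReal_congr ?_
  have hpos := (hE.ae_iff (p := fun x => 0 < x) measurableSet_Ioi.mem).2
    (ae_kappaMuLaw_pos _ _ _ (integrable_kappaMuPDF μ hκE hgE).1.aemeasurable)
  filter_upwards [hpos] with ω hω
  exact propext (secrecyCapacity_pos_iff hω)
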